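/- Let $A$ be a (not necessarily unital) $C^*$-algebra and let $E$ be a Hilbert $C^*$-module over $A$, i.e. a right $A$-module (equivalently, a left module over the opposite algebra) with an $A$-valued inner product $\langle\cdot,\cdot\rangle$, conjugate linear in the first and linear in the second variable, which is complete for the norm $\|x\|=\|\langle x,x\rangle\|^{1/2}$. All operators in $E$ are defined on dense $A$-submodules. For such an operator $S$, the adjoint $S^*$ is given by: $y\in\operatorname{dom}S^*$ and $S^*y=z$ if and only if $\langle Sx,y\rangle=\langle x,z\rangle$ for all $x\in\operatorname{dom}S$. The operator $S$ is called symmetric if $S\subset S^*$, selfadjoint if $S=S^*$, and regular if $S$ is closed, $S^*$ is densely defined and $I+S^*S$, with domain $\{x\in\operatorname{dom}S : Sx\in\operatorname{dom}S^*\}$, has dense range. Let $T:\operatorname{dom}T\to E$ be a selfadjoint regular operator and let $V:\operatorname{dom}V\to E$ be a symmetric operator such that $\operatorname{dom}T\subset\operatorname{dom}V$. Suppose that there is a real number $b\ge 0$ such that $$\langle Vx,Vx\rangle\le\langle Tx,Tx\rangle+b\,\langle x,x\rangle\quad\text{in } A\qquad\text{for all }x\in\operatorname{dom}T.$$ Then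 $T+V$ with domain $\operatorname{dom}T$ is essentially selfadjoint and regular; that is, $T+V$ is closable and its closure $\overline{T+V}$ is selfadjoint and regular. -/

import Mathlib

/-!
# Unbounded operators in Hilbert C⋆-modules

`A` is a (not necessarily unital) C⋆-algebra with its usual order, and a Hilbert C⋆-module over `A`
is a complete `CStarModule A E`: the `A`-valued inner product is conjugate linear in the first and
linear in the second variable, and `‖x‖ = ‖⟪x, x⟫‖ ^ (1/2)`. Mathlib writes the module action as
`a • x`, with `⟪x, a • y⟫ = a * ⟪x, y⟫`; a right Hilbert module over `B` is the same thing as a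
`CStarModule` over the opposite C⋆-algebra `A = Bᵐᵒᵖ`. As `A` is arbitrary, right Hilbert modules
are covered.

An operator in `E` is a linear map defined on a subspace of `E`, that is, an element of
`E →ₗ.[ℂ] E`.
-/

namespace HilbertModule

section

variable (A : Type*) {E : Type*} [NonUnitalCStarAlgebra A] [PartialOrder A]
  [NormedAddCommGroup E] [NormedSpace ℂ E] [SMul A E] [CStarModule A E]

/-- The graph of the adjoint of `T`: the pairs `(y, z)` with `⟪T x, y⟫ = ⟪x, z⟫` for all
`x ∈ dom T`. -/
def adjointGraph (T : E →ₗ.[ℂ] E) : Submodule ℂ (E × E) where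
  carrier := {p | ∀ x : T.domain, inner A (T x) p.1 = inner A (x : E) p.2}
  add_mem' := by
    intro p q hp hq x
    simp only [Prod.fst_add, Prod.snd_add, CStarModule.inner_add_right]
    rw [hp x, hq x]
  zero_mem' := by
    intro x
    simp
  smul_mem' := by
    intro c p hp x
    simp only [Prod.smul_fst, Prod.smul_snd, CStarModule.inner_smul_right_complex]
    rw [hp x]

/-- The adjoint `T⋆` of a densely defined operator `T`: its domain consists of all `y` for which
there is `z` with `⟪T x, y⟫ = ⟪x, z⟫` for all `x ∈ dom T`, and then `T⋆ y = z`. -/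
noncomputable def adjoint (T : E →ₗ.[ℂ] E) : E →ₗ.[ℂ] E :=
  (adjointGraph A T).toLinearPMap

/-- The domain of `T` is a dense `A`-submodule of `E`. -/
structure HasDenseDomain (T : E →ₗ.[ℂ] E) : Prop where
  dense : Dense (T.domain : Set E)
  smul_mem : ∀ (a : A) (x : E), x ∈ T.domain → a • x ∈ T.domain

/-- A semiregular operator: it is defined on a dense `A`-submodule, and its adjoint is densely
defined, too. -/
structure IsSemiregular (T : E →ₗ.[ℂ] E) : Prop where
  hasDenseDomain : HasDenseDomain A T
  dense_adjoint : Dense ((adjoint A T).domain : Set E)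

/-- The range of `I + T⋆ T`, where `dom (T⋆ T) = {x ∈ dom T | T x ∈ dom T⋆}`. -/
def rangeOneAddAdjointComp (T : E →ₗ.[ℂ] E) : Set E :=
  {w | ∃ (x : T.domain) (hx : T x ∈ (adjoint A T).domain),
    w = (x : E) + adjoint A T ⟨T x, hx⟩}

/-- A regular operator: closed, semiregular, and such that `I + T⋆ T` has dense range. -/
structure IsRegular (T : E →ₗ.[ℂ] E) : Prop where
  isClosed : T.IsClosed
  isSemiregular : IsSemiregular A T
  dense_range : Dense (rangeOneAddAdjointComp A T)

/-- A symmetric operator: defined on a dense `A`-submodule, and `T ⊆ T⋆`. -/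
structure IsSymmetric (T : E →ₗ.[ℂ] E) : Prop where
  hasDenseDomain : HasDenseDomain A T
  le_adjoint : T ≤ adjoint A T

/-- A selfadjoint operator: defined on a dense `A`-submodule, and `T = T⋆`. -/
structure IsSelfadjoint (T : E →ₗ.[ℂ] E) : Prop where
  hasDenseDomain : HasDenseDomain A T
  eq_adjoint : T = adjoint A T

end

section

variable (A : Type*) {E : Type*} [NonUnitalCStarAlgebra A] [PartialOrder A] [StarOrderedRing A]
  [NormedAddCommGroup E] [NormedSpace ℂ E] [SMul A E] [CStarModule A E]

/-- For densely defined `T`, the graph of the adjoint is what it should be. -/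
theorem graph_adjoint {T : E →ₗ.[ℂ] E} (hT : Dense (T.domain : Set E)) :
    (adjoint A T).graph = adjointGraph A T := by
  refine Submodule.toLinearPMap_graph_eq _ ?_
  rintro ⟨y, z⟩ hp (rfl : y = 0)
  have h0 : ∀ x : E, x ∈ T.domain → inner A x z = 0 := by
    intro x hx
    have := hp ⟨x, hx⟩
    simpa using this.symm
  have hc : Continuous fun x : E => inner A x z :=
    (CStarModule.continuous_inner (A := A) (E := E)).comp (by fun_prop : Continuous fun x : E => (x, z))
  have hz : inner A z z = 0 :=
    congrFun (hc.ext_on hT continuous_const (fun x hx => h0 x hx)) z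
  exact CStarModule.inner_self.mp hz

end

end HilbertModule

/-! This is Wüst's theorem. For symmetric `S` and real `μ`, `⟪(S + iμ)x, (S + iμ)x⟫ = ⟪Sx, Sx⟫ +
μ²⟪x, x⟫`, so once `μ² ≥ b` the hypothesis gives `‖Vx‖ ≤ ‖(T ± iμ)x‖`. The relative bound is exactly
`1`, so a Neumann series only makes `T + (1 - s)V ± iμ` surjective for `0 < s < 1`. Solving `(T + (1
- s)V + iμ)x = h` gives `(T + V + iμ)x = h + sVx`, where `sVx` stays bounded by `‖h‖` and tends
weakly to `0` as `s → 0`, because `⟪z', sVx⟫ = s⟪Vz', x⟫` for `z' ∈ dom V` and `x` stays bounded.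

Orthogonal complements and weak compactness are not available in Hilbert modules. A Banach–Saks
average replaces them: errors chosen successively, each almost orthogonal to the sum of the earlier
ones, have means tending to `0` in norm (`mem_closure_of_almost_orthogonal`). Hence `T + V ± iμ` has
dense range (`dense_range_shift_add`). For the closure this range is closed, so it is everything;
surjectivity moves from `±μ` to `±1`, and `S ± i` surjective gives selfadjointness and regularity.
-/

namespace HilbertModule

open Complex

/-! ### Neumann perturbation and the operators `T + iμ` -/

section

variable {E : Type*} [NormedAddCommGroup E] [NormedSpace ℂ E]

/-- If `P` is surjective onto a Banach space and `Q` is `P`-bounded with bound less than `1`,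
then `P + Q` is surjective. -/
theorem surjective_add_of_norm_le [CompleteSpace E] {D : Type*} [AddCommGroup D] [Module ℂ D]
    (P Q : D →ₗ[ℂ] E) (hP : Function.Surjective P) {c : ℝ} (hc0 : 0 ≤ c) (hc : c < 1)
    (h : ∀ x, ‖Q x‖ ≤ c * ‖P x‖) : Function.Surjective (P + Q) := by
  -- `R` is only linear, but `Q ∘ R` is bounded by `c` since `P ∘ R = 1`. Thus `(P + Q) ∘ R = 1 + K`
  -- is invertible.
  obtain ⟨R, hR⟩ := P.exists_rightInverse_of_surjective (LinearMap.range_eq_top.2 hP)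
  have hR' : ∀ w, P (R w) = w := fun w => LinearMap.congr_fun hR w
  let K : E →L[ℂ] E := LinearMap.mkContinuous (Q ∘ₗ R) c fun w => by
    simpa [hR'] using h (R w)
  have hK : ‖-K‖ < 1 := by
    rw [norm_neg]
    exact (LinearMap.mkContinuous_norm_le _ hc0 _).trans_lt hc
  obtain ⟨u, hu⟩ := isUnit_one_sub_of_norm_lt_one hK
  intro y
  refine ⟨R ((↑u⁻¹ : E →L[ℂ] E) y), ?_⟩
  have h1 : (1 - -K) ((↑u⁻¹ : E →L[ℂ] E) y) = y := by
    rw [← hu, ← mul_apply_eq_comp, u.mul_inv, one_apply_eq_self]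
  have h2 : K ((↑u⁻¹ : E →L[ℂ] E) y) = Q (R ((↑u⁻¹ : E →L[ℂ] E) y)) := rfl
  rw [sub_neg_eq_add, add_apply, one_apply_eq_self, h2] at h1
  rw [LinearMap.add_apply, hR', h1]

/-- The operator `T + iμ` on the domain of `T`. -/
noncomputable def shift (T : E →ₗ.[ℂ] E) (μ : ℝ) : T.domain →ₗ[ℂ] E :=
  T.toFun + ((μ : ℂ) * I) • T.domain.subtype

theorem shift_apply (T : E →ₗ.[ℂ] E) (μ : ℝ) (x : T.domain) :
    shift T μ x = T x + ((μ : ℂ) * I) • (x : E) := rfl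

theorem exists_shift_eq_of_mem_graph {T : E →ₗ.[ℂ] E} {x y : E} (h : (x, y) ∈ T.graph) (μ : ℝ) :
    ∃ w : T.domain, (w : E) = x ∧ shift T μ w = y + ((μ : ℂ) * I) • x := by
  obtain ⟨w, hw, hy⟩ := (T.mem_graph_iff).1 h
  refine ⟨w, hw, ?_⟩
  rw [shift_apply, hy, hw]

end

/-! ### Inner product estimates and averaging -/

section

variable {A E : Type*} [NonUnitalCStarAlgebra A] [PartialOrder A] [StarOrderedRing A]
  [NormedAddCommGroup E] [NormedSpace ℂ E] [SMul A E] [CStarModule A E]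

variable (A) in
theorem norm_le_norm_of_inner_self_le {x y : E} (h : inner A x x ≤ inner A y y) :
    ‖x‖ ≤ ‖y‖ := by
  rw [CStarModule.norm_eq_sqrt_norm_inner_self (A := A) x,
    CStarModule.norm_eq_sqrt_norm_inner_self (A := A) y]
  exact Real.sqrt_le_sqrt
    (CStarAlgebra.norm_le_norm_of_nonneg_of_le CStarModule.inner_self_nonneg h)

/-- The cross terms `iμ⟪u, x⟫` and `-iμ⟪x, u⟫` cancel. -/
theorem inner_add_mul_I_smul_self {x u : E} (h : inner A u x = inner A x u) (μ : ℝ) :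
    inner A (u + ((μ : ℂ) * I) • x) (u + ((μ : ℂ) * I) • x) =
      inner A u u + (μ ^ 2) • inner A x x := by
  have hμ : (μ ^ 2) • inner A x x = (((μ : ℂ) ^ 2)) • inner A x x := by
    rw [← Complex.coe_smul]
    push_cast
    rfl
  have hI : (μ : ℂ) * I * (μ * -I) = (μ : ℂ) ^ 2 := by
    linear_combination -(μ : ℂ) ^ 2 * Complex.I_sq
  simp only [hμ, ← hI, CStarModule.inner_add_right, CStarModule.inner_add_left,
    CStarModule.inner_smul_left_complex, CStarModule.inner_smul_right_complex, h, star_mul',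
    Complex.star_def, Complex.conj_ofReal, Complex.conj_I]
  module

theorem abs_mul_norm_le_norm_add {x u : E} (h : inner A u x = inner A x u) (μ : ℝ) :
    |μ| * ‖x‖ ≤ ‖u + ((μ : ℂ) * I) • x‖ := by
  have : ‖(μ : ℂ) • x‖ ≤ ‖u + ((μ : ℂ) * I) • x‖ := by
    refine norm_le_norm_of_inner_self_le A ?_
    rw [inner_add_mul_I_smul_self h, Complex.coe_smul, CStarModule.inner_smul_left_real,
      CStarModule.inner_smul_right_real, smul_smul, ← sq]
    exact le_add_of_nonneg_left CStarModule.inner_self_nonneg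
  rwa [norm_smul, Complex.norm_real, Real.norm_eq_abs] at this

variable (A) in
theorem ext_inner_dense {s : Set E} (hs : Dense s) {y z : E}
    (h : ∀ x ∈ s, inner A x y = inner A x z) : y = z := by
  have hc : ∀ w : E, Continuous fun x : E => inner A x w := fun w =>
    (CStarModule.continuous_inner (A := A) (E := E)).comp
      (by fun_prop : Continuous fun x : E => (x, w))
  have h0 := congrFun ((hc y).ext_on hs (hc z) h) (y - z)
  rw [← sub_eq_zero, ← CStarModule.inner_sub_right] at h0
  exact sub_eq_zero.1 (CStarModule.inner_self.1 h0)

-- Needed to see that the domain of a closure is again an `A`-submodule. Additivity of the action is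
-- itself recovered from the inner product.
variable (E) in
theorem continuous_const_smul_module (a : A) : Continuous fun x : E => a • x := by
  have hsub : ∀ x y : E, a • x - a • y = a • (x - y) := fun x y =>
    ext_inner_dense A (dense_univ (X := E)) fun z _ => by simp [mul_sub]
  refine (LipschitzWith.of_dist_le_mul (K := ‖a‖₊) fun x y => ?_).continuous
  rw [dist_eq_norm, dist_eq_norm, hsub, coe_nnnorm]
  refine (sq_le_sq₀ (norm_nonneg _) (by positivity)).1 ?_
  rw [CStarModule.norm_sq_eq A, mul_pow,
    CStarModule.norm_sq_eq A (x := x - y), CStarModule.inner_op_smul_right, CStarModule.inner_op_smul_left]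
  calc _ ≤ ‖a‖ * (‖inner A (x - y) (x - y)‖ * ‖star a‖) :=
        (norm_mul_le _ _).trans (by gcongr; exact norm_mul_le _ _)
    _ = _ := by rw [norm_star]; ring

/-- If the set `{y | h + y ∈ R}` has norm bounded elements that are almost orthogonal to any given
vector, then `h` is in the closure of `R`. -/
theorem mem_closure_of_almost_orthogonal (R : Submodule ℂ E) (h : E) {C : ℝ}
    (H : ∀ z : E, ∃ y : E, ‖y‖ ≤ C ∧ ‖inner A z y‖ ≤ 1 ∧ h + y ∈ R) :
    h ∈ closure (R : Set E) := by
  -- `s` is a sum of `n` errors. Each new one adds at most `C²` plus two cross terms of norm at most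
  -- `1`, so `‖s‖²` grows linearly and `s / n → 0`.
  have key : ∀ n : ℕ, ∃ s : E, ‖s‖ ^ 2 ≤ n * (C ^ 2 + 2) ∧ (n : ℂ) • h + s ∈ R := by
    intro n
    induction n with
    | zero => exact ⟨0, by simp⟩
    | succ n ih =>
      obtain ⟨s, hs, hsR⟩ := ih
      obtain ⟨y, hy, hzy, hyR⟩ := H s
      refine ⟨s + y, ?_, ?_⟩
      · have h1 : ‖inner A y s‖ ≤ 1 := by
          rwa [← CStarModule.star_inner s y, norm_star]
        have h2 : ‖y‖ ^ 2 ≤ C ^ 2 := pow_le_pow_left₀ (norm_nonneg _) hy 2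
        rw [CStarModule.norm_sq_eq A] at hs h2 ⊢
        rw [CStarModule.inner_add_left, CStarModule.inner_add_right, CStarModule.inner_add_right]
        have h3 := norm_add_le (inner A s s + inner A s y) (inner A y s + inner A y y)
        have h4 := norm_add_le (inner A s s) (inner A s y)
        have h5 := norm_add_le (inner A y s) (inner A y y)
        push_cast
        linarith
      · have := R.add_mem hsR hyR
        convert this using 1
        push_cast
        module
  rw [Metric.mem_closure_iff]
  intro ε hε
  obtain ⟨n, hn⟩ := exists_nat_gt ((C ^ 2 + 2) / ε ^ 2)
  have hn0 : (0 : ℝ) < n := lt_of_le_of_lt (by positivity) hn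
  obtain ⟨s, hs, hsR⟩ := key n
  refine ⟨(n : ℂ)⁻¹ • ((n : ℂ) • h + s), R.smul_mem _ hsR, ?_⟩
  have hn' : (n : ℂ) ≠ 0 := by exact_mod_cast hn0.ne'
  rw [smul_add, smul_smul, inv_mul_cancel₀ hn', one_smul, dist_self_add_right, norm_smul,
    norm_inv, Complex.norm_natCast, inv_mul_lt_iff₀ hn0]
  refine lt_of_pow_lt_pow_left₀ 2 (by positivity) (hs.trans_lt ?_)
  rw [div_lt_iff₀ (by positivity)] at hn
  rw [mul_pow]
  nlinarith

theorem mem_graph_adjoint_iff {T : E →ₗ.[ℂ] E} (hT : Dense (T.domain : Set E)) {y z : E} :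
    (y, z) ∈ (adjoint A T).graph ↔ ∀ x : T.domain, inner A (T x) y = inner A (x : E) z := by
  rw [graph_adjoint A hT]
  rfl

theorem isClosed_adjointGraph (T : E →ₗ.[ℂ] E) :
    IsClosed (adjointGraph A T : Set (E × E)) := by
  have : (adjointGraph A T : Set (E × E)) =
      ⋂ x : T.domain, {p | inner A (T x) p.1 = inner A (x : E) p.2} := by
    ext p
    simp only [Set.mem_iInter]
    rfl
  rw [this]
  refine isClosed_iInter fun x => isClosed_eq ?_ ?_
  · exact (CStarModule.continuous_inner (A := A) (E := E)).comp
      (by fun_prop : Continuous fun p : E × E => (T x, p.1))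
  · exact (CStarModule.continuous_inner (A := A) (E := E)).comp
      (by fun_prop : Continuous fun p : E × E => ((x : E), p.2))

theorem IsSelfadjoint.isSymmetric {T : E →ₗ.[ℂ] E} (hT : IsSelfadjoint A T) : IsSymmetric A T :=
  ⟨hT.hasDenseDomain, hT.eq_adjoint.le⟩

/-! ### Symmetric operators, the range of `T + iμ`, and closures -/

namespace IsSymmetric

variable {T : E →ₗ.[ℂ] E}

theorem inner_map_left (hT : IsSymmetric A T) (x y : T.domain) :
    inner A (T x) (y : E) = inner A (x : E) (T y) :=
  (mem_graph_adjoint_iff hT.hasDenseDomain.dense).1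
    (LinearPMap.le_graph_of_le hT.le_adjoint (T.mem_graph y)) x

theorem of_inner_map_left (hd : HasDenseDomain A T)
    (h : ∀ x y : T.domain, inner A (T x) (y : E) = inner A (x : E) (T y)) : IsSymmetric A T := by
  refine ⟨hd, LinearPMap.le_of_le_graph ?_⟩
  rintro ⟨y, z⟩ hyz
  obtain ⟨w, rfl, rfl⟩ := (T.mem_graph_iff).1 hyz
  exact (mem_graph_adjoint_iff hd.dense).2 fun x => h x w

theorem map_smul (hT : IsSymmetric A T) (a : A) (x : T.domain) :
    T ⟨a • (x : E), hT.hasDenseDomain.smul_mem a x x.2⟩ = a • T x := by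
  refine ext_inner_dense A hT.hasDenseDomain.dense fun y hy => ?_
  rw [← hT.inner_map_left ⟨y, hy⟩, CStarModule.inner_op_smul_right,
    CStarModule.inner_op_smul_right, hT.inner_map_left ⟨y, hy⟩ x]

theorem inner_shift_self (hT : IsSymmetric A T) (μ : ℝ) (x : T.domain) :
    inner A (shift T μ x) (shift T μ x) =
      inner A (T x) (T x) + (μ ^ 2) • inner A (x : E) (x : E) :=
  inner_add_mul_I_smul_self (hT.inner_map_left x x) μ

theorem norm_map_le_norm_shift (hT : IsSymmetric A T) (μ : ℝ) (x : T.domain) :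
    ‖T x‖ ≤ ‖shift T μ x‖ := by
  refine norm_le_norm_of_inner_self_le A ?_
  rw [hT.inner_shift_self]
  exact le_add_of_nonneg_right (smul_nonneg (sq_nonneg μ) CStarModule.inner_self_nonneg)

theorem norm_le_norm_shift (hT : IsSymmetric A T) (μ : ℝ) (x : T.domain) :
    |μ| * ‖(x : E)‖ ≤ ‖shift T μ x‖ :=
  abs_mul_norm_le_norm_add (hT.inner_map_left x x) μ

/-- `T + iμ`, viewed on the complete space `T.graph`, is bounded below. -/
theorem isClosed_range_shift [CompleteSpace E] (hT : IsSymmetric A T) (hc : T.IsClosed) {μ : ℝ}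
    (hμ : μ ≠ 0) : IsClosed (LinearMap.range (shift T μ) : Set E) := by
  have hμ' : 0 < |μ| := abs_pos.2 hμ
  let f : T.graph →L[ℂ] E :=
    (ContinuousLinearMap.snd ℂ E E + ((μ : ℂ) * I) • ContinuousLinearMap.fst ℂ E E).comp
      T.graph.subtypeL
  have hf : ∀ p : T.graph, f p = (p : E × E).2 + ((μ : ℂ) * I) • (p : E × E).1 := fun p => rfl
  have hanti : AntilipschitzWith (1 + |μ|⁻¹).toNNReal f := by
    refine AddMonoidHomClass.antilipschitz_of_bound f fun p => ?_
    obtain ⟨w, hw, hy⟩ := (T.mem_graph_iff).1 p.2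
    have h0 : f p = shift T μ w := by rw [hf, shift_apply, hw, hy]
    have h1 := hT.norm_map_le_norm_shift μ w
    have h2 := hT.norm_le_norm_shift μ w
    rw [← le_inv_mul_iff₀ hμ'] at h2
    rw [h0, Real.coe_toNNReal _ (by positivity), Submodule.coe_norm, Prod.norm_def, ← hw, ← hy,
      add_mul, one_mul]
    exact max_le (h2.trans (le_add_of_nonneg_left (norm_nonneg _)))
      (h1.trans (le_add_of_nonneg_right (by positivity)))
  have : CompleteSpace T.graph := IsClosed.completeSpace_coe (hs := hc)
  have hr := hanti.isClosed_range f.uniformContinuous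
  convert hr using 1
  ext y
  constructor
  · rintro ⟨w, rfl⟩
    exact ⟨⟨_, T.mem_graph w⟩, rfl⟩
  · rintro ⟨p, rfl⟩
    obtain ⟨w, -, hy⟩ := exists_shift_eq_of_mem_graph p.2 μ
    exact ⟨w, hy⟩

theorem surjective_shift_of_dense [CompleteSpace E] (hT : IsSymmetric A T) (hc : T.IsClosed)
    {μ : ℝ} (hμ : μ ≠ 0) (hd : Dense (LinearMap.range (shift T μ) : Set E)) :
    Function.Surjective (shift T μ) := by
  rw [← LinearMap.range_eq_top, ← SetLike.coe_set_eq, Submodule.top_coe,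
    ← (hT.isClosed_range_shift hc hμ).closure_eq]
  exact hd.closure_eq

/-- `i(ν - μ)` is bounded relative to `T + iμ` with bound `|ν - μ| / |μ| < 1`. -/
theorem surjective_shift_of_abs_sub_lt [CompleteSpace E] (hT : IsSymmetric A T) {μ ν : ℝ}
    (h : |ν - μ| < |μ|) (hs : Function.Surjective (shift T μ)) :
    Function.Surjective (shift T ν) := by
  have hμ : 0 < |μ| := (abs_nonneg _).trans_lt h
  have heq : shift T ν = shift T μ + (((ν - μ : ℝ) : ℂ) * I) • T.domain.subtype := by
    ext x
    simp only [LinearMap.add_apply, shift_apply, LinearMap.smul_apply, Submodule.subtype_apply]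
    push_cast
    module
  rw [heq]
  refine surjective_add_of_norm_le _ _ hs (c := |ν - μ| / |μ|) (by positivity)
    ((div_lt_one hμ).2 h) fun x => ?_
  have h2 := hT.norm_le_norm_shift μ x
  rw [LinearMap.smul_apply, norm_smul, norm_mul, Complex.norm_I, mul_one, Complex.norm_real,
    Real.norm_eq_abs, div_mul_eq_mul_div, mul_div_assoc]
  gcongr
  rw [le_div_iff₀' hμ]
  exact h2

theorem exists_le_surjective_shift [CompleteSpace E] (hT : IsSymmetric A T)
    (h₁ : Function.Surjective (shift T 1)) (h₂ : Function.Surjective (shift T (-1))) (r : ℝ) :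
    ∃ μ : ℝ, 1 ≤ μ ∧ r ≤ μ ∧ Function.Surjective (shift T μ) ∧
      Function.Surjective (shift T (-μ)) := by
  -- Any ratio strictly between `1` and `2` would do: below `2` each step is a small perturbation,
  -- above `1` the powers are unbounded.
  have key : ∀ n : ℕ, Function.Surjective (shift T ((3 / 2 : ℝ) ^ n)) ∧
      Function.Surjective (shift T (-(3 / 2 : ℝ) ^ n)) := by
    intro n
    induction n with
    | zero => simpa using ⟨h₁, h₂⟩
    | succ n ih =>
      have hp : (0 : ℝ) < (3 / 2) ^ n := by positivity
      constructor
      · refine hT.surjective_shift_of_abs_sub_lt ?_ ih.1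
        rw [abs_of_pos hp, pow_succ, abs_lt]
        constructor <;> linarith
      · refine hT.surjective_shift_of_abs_sub_lt ?_ ih.2
        rw [abs_neg, abs_of_pos hp, pow_succ, abs_lt]
        constructor <;> linarith
  obtain ⟨n, hn⟩ := pow_unbounded_of_one_lt r (by norm_num : (1 : ℝ) < 3 / 2)
  exact ⟨_, one_le_pow₀ (by norm_num), hn.le, key n⟩

/-- For `y ∈ dom T⋆`, solve `(T + iμ)x = T⋆y + iμy` in `dom T`. Then `y - x` is orthogonal to the
range of `T - iμ`, which is all of `E`. -/
theorem isSelfadjoint_of_surjective_shift (hT : IsSymmetric A T) {μ : ℝ}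
    (h₁ : Function.Surjective (shift T μ)) (h₂ : Function.Surjective (shift T (-μ))) :
    IsSelfadjoint A T := by
  refine ⟨hT.hasDenseDomain, hT.le_adjoint.antisymm (LinearPMap.le_of_le_graph ?_)⟩
  rintro ⟨y, z⟩ hyz
  rw [mem_graph_adjoint_iff hT.hasDenseDomain.dense] at hyz
  obtain ⟨x, hx⟩ := h₁ (z + ((μ : ℂ) * I) • y)
  have hyx : y = x := by
    refine ext_inner_dense A (dense_univ (X := E)) fun w _ => ?_
    obtain ⟨v, rfl⟩ := h₂ w
    have h3 : inner A (v : E) (shift T μ x) = inner A (v : E) (z + ((μ : ℂ) * I) • y) := by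
      rw [hx]
    have e : star (((-μ : ℝ) : ℂ) * I) = (μ : ℂ) * I := by simp
    simp only [shift_apply, CStarModule.inner_add_right, CStarModule.inner_smul_right_complex,
      CStarModule.inner_add_left, CStarModule.inner_smul_left_complex, e, hyz,
      hT.inner_map_left] at h3 ⊢
    exact h3.symm
  have hz : T x = z := by
    rw [shift_apply, hyx] at hx
    exact add_right_cancel hx
  rw [T.mem_graph_iff]
  exact ⟨x, hyx.symm, hz⟩

theorem isClosable (hT : IsSymmetric A T) : T.IsClosable :=
  LinearPMap.isClosable_iff_exists_closed_extension.2 ⟨adjoint A T, by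
    rw [LinearPMap.IsClosed, graph_adjoint A hT.hasDenseDomain.dense]
    exact isClosed_adjointGraph T, hT.le_adjoint⟩

theorem closure_isSymmetric (hT : IsSymmetric A T) : IsSymmetric A T.closure := by
  have hg := hT.isClosable.graph_closure_eq_closure_graph
  have hd := hT.hasDenseDomain.dense
  have hle : T.closure.graph ≤ adjointGraph A T := by
    rw [← hg]
    refine Submodule.topologicalClosure_minimal _ ?_ (isClosed_adjointGraph T)
    rw [← graph_adjoint A hd]
    exact LinearPMap.le_graph_of_le hT.le_adjoint
  refine of_inner_map_left ⟨hd.mono T.le_closure.1, fun a x hx => ?_⟩ fun x y => ?_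
  · have hmaps : Set.MapsTo (fun p : E × E => (a • p.1, a • p.2)) T.graph T.graph := by
      rintro ⟨y, z⟩ hyz
      obtain ⟨w, rfl, rfl⟩ := (T.mem_graph_iff).1 hyz
      exact (T.mem_graph_iff).2
        ⟨⟨a • (w : E), hT.hasDenseDomain.smul_mem a w w.2⟩, rfl, hT.map_smul a w⟩
    have hcont : Continuous fun p : E × E => (a • p.1, a • p.2) :=
      ((continuous_const_smul_module E a).comp continuous_fst).prodMk
        ((continuous_const_smul_module E a).comp continuous_snd)
    have hmem : (x, T.closure ⟨x, hx⟩) ∈ T.graph.topologicalClosure := by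
      rw [hg]
      exact T.closure.mem_graph ⟨x, hx⟩
    have hcl : (a • x, a • T.closure ⟨x, hx⟩) ∈ T.graph.topologicalClosure :=
      hmaps.closure hcont hmem
    rw [hg] at hcl
    exact LinearPMap.mem_domain_of_mem_graph hcl
  -- With `y` fixed in the domain of the closure, symmetry already holds against `dom T`; it passes
  -- to the limit in the first argument.
  · let B : Set (E × E) := {p | inner A p.2 (y : E) = inner A p.1 (T.closure y)}
    have hB : IsClosed B := isClosed_eq
      ((CStarModule.continuous_inner (A := A) (E := E)).comp
        (by fun_prop : Continuous fun p : E × E => (p.2, (y : E))))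
      ((CStarModule.continuous_inner (A := A) (E := E)).comp
        (by fun_prop : Continuous fun p : E × E => (p.1, T.closure y)))
    have hsub : (T.graph : Set (E × E)) ⊆ B := by
      rintro ⟨v, w⟩ hvw
      obtain ⟨u, rfl, rfl⟩ := (T.mem_graph_iff).1 hvw
      exact hle (T.closure.mem_graph y) u
    have hx : ((x : E), T.closure x) ∈ T.graph.topologicalClosure := by
      rw [hg]
      exact T.closure.mem_graph x
    exact closure_minimal hsub hB hx

end IsSymmetric

/-! ### Regularity and surjectivity of `T ± i` -/

/-- A closed selfadjoint operator `T` with `T + i` and `T - i` surjective is regular. -/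
theorem IsSelfadjoint.isRegular_of_surjective_shift {T : E →ₗ.[ℂ] E} (hT : IsSelfadjoint A T)
    (hc : T.IsClosed) (h₁ : Function.Surjective (shift T 1))
    (h₂ : Function.Surjective (shift T (-1))) : IsRegular A T := by
  refine ⟨hc, ⟨hT.hasDenseDomain, hT.eq_adjoint ▸ hT.hasDenseDomain.dense⟩, ?_⟩
  have : rangeOneAddAdjointComp A T = Set.univ := by
    refine Set.eq_univ_of_forall fun w => ?_
    -- Factor `I + T² = (T + i)(T - i)`: `w = (T + i)u` and `u = (T - i)x`.
    obtain ⟨u, hu⟩ := h₁ w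
    obtain ⟨x, hx⟩ := h₂ u
    have hTx : T x = (u : E) + I • (x : E) := by
      rw [← hx, shift_apply]
      push_cast
      module
    have hmem : T x ∈ T.domain := by
      rw [hTx]
      exact T.domain.add_mem u.2 (T.domain.smul_mem _ x.2)
    have hmem' : T x ∈ (adjoint A T).domain := hT.eq_adjoint ▸ hmem
    refine ⟨x, hmem', ?_⟩
    have h3 : adjoint A T ⟨T x, hmem'⟩ = T ⟨T x, hmem⟩ :=
      (hT.eq_adjoint.le.2 rfl).symm
    have h4 : (⟨T x, hmem⟩ : T.domain) = u + I • x := Subtype.ext hTx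
    rw [h3, h4, LinearPMap.map_add, LinearPMap.map_smul, hTx, ← hu, shift_apply, smul_add,
      smul_smul, I_mul_I]
    push_cast
    module
  rw [this]
  exact dense_univ

theorem IsRegular.surjective_shift [CompleteSpace E] {T : E →ₗ.[ℂ] E} (hR : IsRegular A T)
    (hT : IsSelfadjoint A T) {μ : ℝ} (hμ : μ ^ 2 = 1) : Function.Surjective (shift T μ) := by
  refine hT.isSymmetric.surjective_shift_of_dense hR.isClosed (by rintro rfl; simp at hμ)
    (hR.dense_range.mono ?_)
  rintro w ⟨x, hx, rfl⟩
  have hmem : T x ∈ T.domain := by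
    have h := hx
    rwa [← hT.eq_adjoint] at h
  have h3 : adjoint A T ⟨T x, hx⟩ = T ⟨T x, hmem⟩ := (hT.eq_adjoint.le.2 rfl).symm
  -- As `μ² = 1`, `(T + iμ)(T - iμ)x = T²x + x`.
  refine ⟨⟨T x, hmem⟩ - ((μ : ℂ) * I) • x, ?_⟩
  have h5 : ((μ : ℂ) * I) * ((μ : ℂ) * I) = -1 := by
    rw [mul_mul_mul_comm, I_mul_I, ← sq, ← Complex.ofReal_pow, hμ]
    simp
  rw [h3, shift_apply, LinearPMap.map_sub, LinearPMap.map_smul, Submodule.coe_sub,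
    Submodule.coe_smul, smul_sub, smul_smul, h5]
  module

/-! ### Dense range at relative bound one -/

/-- If `V` is bounded by `T + iμ` with relative bound `1`, then `T + V + iμ` has dense range. -/
theorem dense_range_shift_add [CompleteSpace E] {T V : E →ₗ.[ℂ] E} (hT : IsSymmetric A T)
    (hV : IsSymmetric A V) (hdom : T.domain ≤ V.domain) {μ : ℝ} (hμ : μ ≠ 0)
    (hs : Function.Surjective (shift T μ))
    (hle : ∀ x : T.domain, ‖V ⟨x, hdom x.2⟩‖ ≤ ‖shift T μ x‖) :
    Dense (LinearMap.range (shift (T + V) μ) : Set E) := by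
  intro h
  have hμ' : 0 < |μ| := abs_pos.2 hμ
  let V' : T.domain →ₗ[ℂ] E := V.toFun ∘ₗ Submodule.inclusion hdom
  have hV' : ∀ x : T.domain, V' x = V ⟨x, hdom x.2⟩ := fun _ => rfl
  refine mem_closure_of_almost_orthogonal (A := A) _ h (C := ‖h‖) fun z => ?_
  have hz : z ∈ closure (V.domain : Set E) := hV.hasDenseDomain.dense z
  -- The tolerance for `z'` and the later choice of `s` each contribute at most `1 / 2` to `‖⟪z,
  -- sVx⟫‖`.
  obtain ⟨z', hz', hzz'⟩ := Metric.mem_closure_iff.1 hz (1 / (2 * (‖h‖ + 1))) (by positivity)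
  let M : ℝ := ‖V ⟨z', hz'⟩‖ * (‖h‖ / |μ|)
  have hM : 0 ≤ M := by positivity
  let s : ℝ := 1 / (2 * (M + 1))
  have hs0 : 0 < s := by positivity
  have hs1 : s < 1 := by
    rw [div_lt_one (by positivity)]
    linarith
  have hsM : s * M ≤ 1 / 2 := by
    rw [div_mul_eq_mul_div, one_mul, div_le_div_iff₀ (by positivity) (by positivity)]
    linarith
  obtain ⟨x, hx⟩ := surjective_add_of_norm_le (shift T μ) (((1 - s : ℝ) : ℂ) • V') hs
    (c := 1 - s) (by linarith) (by linarith) (fun x => by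
      rw [LinearMap.smul_apply, norm_smul, Complex.norm_real, Real.norm_eq_abs,
        abs_of_pos (by linarith)]
      gcongr
      exact hle x) h
  rw [LinearMap.add_apply, LinearMap.smul_apply] at hx
  -- `‖Vx‖ ≤ ‖(T + iμ)x‖ ≤ ‖h‖ + (1 - s)‖Vx‖`; the coefficient `1 - s` leaves exactly `s‖Vx‖`.
  have hbd : s * ‖V' x‖ ≤ ‖h‖ := by
    have h1 : ‖shift T μ x‖ ≤ ‖h‖ + (1 - s) * ‖V' x‖ := by
      rw [eq_sub_of_add_eq hx]
      refine (norm_sub_le _ _).trans (le_of_eq ?_)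
      rw [norm_smul, Complex.norm_real, Real.norm_eq_abs, abs_of_pos (by linarith)]
    have h2 : ‖V' x‖ ≤ ‖shift T μ x‖ := hle x
    linarith
  -- This bound on `x` is uniform in `s`, since `T + (1 - s)V` is symmetric.
  have hxs : |μ| * ‖(x : E)‖ ≤ ‖h‖ := by
    have hsym : inner A (T x + ((1 - s : ℝ) : ℂ) • V' x) (x : E) =
        inner A (x : E) (T x + ((1 - s : ℝ) : ℂ) • V' x) := by
      rw [Complex.coe_smul, CStarModule.inner_add_left, CStarModule.inner_add_right,
        CStarModule.inner_smul_left_real, CStarModule.inner_smul_right_real,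
        hT.inner_map_left x x, hV', hV.inner_map_left ⟨x, hdom x.2⟩ ⟨x, hdom x.2⟩]
    refine (abs_mul_norm_le_norm_add hsym μ).trans_eq ?_
    rw [← hx, shift_apply, add_right_comm]
  have hdx : (x : E) ∈ (T + V).domain := ⟨x.2, hdom x.2⟩
  refine ⟨(s : ℂ) • V' x, ?_, ?_, ⟨x, hdx⟩, ?_⟩
  · rwa [norm_smul, Complex.norm_real, Real.norm_eq_abs, abs_of_pos hs0]
  · have e : inner A z ((s : ℂ) • V' x) =
        inner A (z - z') ((s : ℂ) • V' x) + s • inner A (V ⟨z', hz'⟩) (x : E) := by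
      rw [CStarModule.inner_sub_left, hV.inner_map_left ⟨z', hz'⟩ ⟨x, hdom x.2⟩, ← hV',
        Complex.coe_smul, CStarModule.inner_smul_right_real, CStarModule.inner_smul_right_real]
      simp
    rw [e]
    have h1 : ‖inner A (z - z') ((s : ℂ) • V' x)‖ ≤ 1 / 2 := by
      refine (CStarModule.norm_inner_le E).trans ?_
      rw [norm_smul, Complex.norm_real, Real.norm_eq_abs, abs_of_pos hs0, ← dist_eq_norm]
      calc _ ≤ (1 / (2 * (‖h‖ + 1))) * ‖h‖ := by gcongr
        _ ≤ 1 / 2 := by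
          rw [div_mul_eq_mul_div, one_mul, div_le_div_iff₀ (by positivity) (by positivity)]
          linarith
    have h2 : ‖s • inner A (V ⟨z', hz'⟩) (x : E)‖ ≤ 1 / 2 := by
      rw [norm_smul, Real.norm_eq_abs, abs_of_pos hs0]
      refine (mul_le_mul_of_nonneg_left ((CStarModule.norm_inner_le E).trans ?_) hs0.le).trans hsM
      refine mul_le_mul_of_nonneg_left ?_ (norm_nonneg _)
      rwa [le_div_iff₀' hμ']
    linarith [norm_add_le (inner A (z - z') ((s : ℂ) • V' x))
      (s • inner A (V ⟨z', hz'⟩) (x : E))]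
  · rw [← hx, shift_apply, shift_apply, hV']
    have : (T + V) ⟨x, hdx⟩ = T x + V ⟨x, hdom x.2⟩ := rfl
    rw [this]
    push_cast
    module

end

end HilbertModule

/-! ### The main theorem -/

theorem theorem4 {A E : Type*}
    [NonUnitalCStarAlgebra A] [PartialOrder A] [StarOrderedRing A]
    [NormedAddCommGroup E] [NormedSpace ℂ E] [SMul A E] [CStarModule A E] [CompleteSpace E]
    (T V : E →ₗ.[ℂ] E)
    (hT : HilbertModule.IsSelfadjoint A T) (hTreg : HilbertModule.IsRegular A T)
    (hV : HilbertModule.IsSymmetric A V)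
    (hdom : T.domain ≤ V.domain)
    (b : ℝ) (hb : 0 ≤ b)
    (hbound : ∀ x : T.domain,
      inner A (V ⟨x, hdom x.2⟩) (V ⟨x, hdom x.2⟩) ≤
        inner A (T x) (T x) + b • inner A (x : E) (x : E)) :
    (T + V).domain = T.domain ∧ (T + V).IsClosable ∧
      HilbertModule.IsSelfadjoint A (T + V).closure ∧
      HilbertModule.IsRegular A (T + V).closure := by
  have hTs := hT.isSymmetric
  have hd : (T + V).domain = T.domain := inf_eq_left.2 hdom
  have hW : HilbertModule.IsSymmetric A (T + V) := by
    refine .of_inner_map_left ⟨hd ▸ hT.hasDenseDomain.dense, fun a x hx =>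
      ⟨hT.hasDenseDomain.smul_mem a x hx.1, hV.hasDenseDomain.smul_mem a x hx.2⟩⟩ fun x y => ?_
    change inner A (T ⟨x, x.2.1⟩ + V ⟨x, x.2.2⟩) (y : E) =
      inner A (x : E) (T ⟨y, y.2.1⟩ + V ⟨y, y.2.2⟩)
    rw [CStarModule.inner_add_left, CStarModule.inner_add_right,
      hTs.inner_map_left ⟨x, x.2.1⟩ ⟨y, y.2.1⟩, hV.inner_map_left ⟨x, x.2.2⟩ ⟨y, y.2.2⟩]
  have hcl := hW.isClosable.closure_isClosed
  have hS := hW.closure_isSymmetric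
  -- `μ ≥ 1` and `μ ≥ b` give `μ² ≥ b`; `μ ≥ 1` also gives `|1 - μ| < μ` for the return to `±1`.
  obtain ⟨μ, hμ1, hμb, hs₁, hs₂⟩ := hTs.exists_le_surjective_shift
    (hTreg.surjective_shift hT (by norm_num)) (hTreg.surjective_shift hT (by norm_num)) b
  have hsurj : ∀ ν : ℝ, ν ^ 2 = μ ^ 2 → Function.Surjective (HilbertModule.shift T ν) →
      Function.Surjective (HilbertModule.shift (T + V).closure ν) := by
    intro ν hν hsν
    have hν0 : ν ≠ 0 := by
      rintro rfl
      nlinarith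
    refine hS.surjective_shift_of_dense hcl hν0
      ((HilbertModule.dense_range_shift_add hTs hV hdom hν0 hsν fun x => ?_).mono ?_)
    · refine HilbertModule.norm_le_norm_of_inner_self_le A ((hbound x).trans ?_)
      rw [hTs.inner_shift_self, hν]
      gcongr
      · exact CStarModule.inner_self_nonneg
      · nlinarith
    · rintro _ ⟨w, rfl⟩
      obtain ⟨v, -, hv⟩ := HilbertModule.exists_shift_eq_of_mem_graph
        (LinearPMap.le_graph_of_le (T + V).le_closure ((T + V).mem_graph w)) ν
      exact ⟨v, hv⟩
  have h₁ : Function.Surjective (HilbertModule.shift (T + V).closure 1) := by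
    refine hS.surjective_shift_of_abs_sub_lt ?_ (hsurj μ rfl hs₁)
    rw [abs_of_pos (by linarith : 0 < μ), abs_lt]
    constructor <;> linarith
  have h₂ : Function.Surjective (HilbertModule.shift (T + V).closure (-1)) := by
    refine hS.surjective_shift_of_abs_sub_lt ?_ (hsurj (-μ) (by ring) hs₂)
    rw [abs_neg, abs_of_pos (by linarith : 0 < μ), abs_lt]
    constructor <;> linarith
  have hsa := hS.isSelfadjoint_of_surjective_shift h₁ h₂
  exact ⟨hd, hW.isClosable, hsa, hsa.isRegular_of_surjective_shift hcl h₁ h₂⟩
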